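/- All spaces are real, $\mathbb N=\{1,2,\dots\}$, and for finite sets $E,F\subset\mathbb N$, $E<F$ means $\max E<\min F$ (or $E$ or $F$ is empty); $n\le E$ means that every element of $E$ is at least $n$. Let $T$ be Tsirelson's space, the completion of the space $c_{00}$ of finitely supported sequences under the norm satisfying $$\|x\|=\max\Big(\|x\|_\infty,\ \sup\Big\{\tfrac12\sum_{i=1}^n\|E_ix\| : n\in\mathbb N,\ n\le E_1<\dots<E_n\Big\}\Big),$$ where $E_ix$ is the restriction of $x$ to the finite set $E_i$, and let $(e_i)$ be its unit vector basis. We write $(y_i)\prec(x_i)$ if $(y_i)$ is a (finite or infinite) block basis of $(x_i)$, that is, the $y_i$ are nonzero finite linear combinations of the $x_j$ with supports $\operatorname{supp}(y_1)<\operatorname{supp}(y_2)<\cdots$ with respect to $(x_j)$. We write $X\prec T$ if $X=[x_i]$ is the closed linear span of an infinite block basis $(x_i)\prec(e_i)$. The Schreier families are $\mathcal S_0=\{\{n\}:n\in\mathbb N\}\cup\{\emptyset\}$, $\mathcal S_1=\{F:|F|\le\min F\}\cup\{\emptyset\}$; $\mathcal S_{\alpha+1}$ consists of all unions $\bigcup_{i=1}^kG_i$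 with $G_1<\dots<G_k$ nonempty members of $\mathcal S_\alpha$ and $\{\min G_i\}_{i=1}^k\in\mathcal S_1$, together with $\emptyset$; and for a limit ordinal $\alpha<\omega_1$, one chooses $\alpha_n\uparrow\alpha$ with $\alpha_n<\alpha$ and lets $\mathcal S_\alpha$ be the set of all $F$ such that $F\in\mathcal S_{\alpha_n}$ and $n\le F$ for some $n$. These choices are arbitrary but fixed. For a norm $|\cdot|$ on a space with basis $(x_i)$ and $\alpha<\omega_1$ let $\delta_\alpha((x_i),|\cdot|)$ be the supremum of all $\delta\ge0$ such that $|\sum_{i=1}^ky_i|\ge\delta\sum_{i=1}^k|y_i|$ whenever $(y_i)_1^k\prec(x_i)$ and $\{\min\operatorname{supp}(y_i)\}_{i=1}^k\in\mathcal S_\alpha$. If $X=[x_i]\prec T$ and $|\cdot|$ is an equivalent norm on $X$, then $\Delta(X,|\cdot|)$ is the set of all $\gamma=(\gamma_\alpha)_{\alpha<\omega_1}\subset\mathbb R$ for which there are an infinite $(z_i)\prec(x_i)$ and $\varepsilon_n\downarrow0$ such that for every $\alpha<\omega_1$ there is $m$ with $$|\delta_\alpha((y_i),|\cdot|)-\gamma_\alpha|<\varepsilon_n\quad\text{for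 all }n\ge m\text{ and all infinite }(y_i)\prec(z_i)_{i\ge n}.$$ The distortion of $|\cdot|$ is $$d(X,|\cdot|)=\inf_Y\sup\Big\{\frac{|u|}{|v|}: u,v\in Y,\ \|u\|=\|v\|=1\Big\},$$ the infimum being over all closed infinite-dimensional linear subspaces $Y$ of $X$. **Theorem.** There is an absolute constant $D<\infty$ with the following property. Let $X\prec T$ and let $|\cdot|$ be an equivalent norm on $X$ such that $\gamma_1=\tfrac12$ for some $\gamma\in\Delta(X,|\cdot|)$. Then $d(X,|\cdot|)\le D$. -/

import Mathlib

open scoped ENNReal Ordinal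

/-! Convention: sequences, coordinates and finite sets of positive integers are indexed from `0`.
The index `i : ℕ` stands for the positive integer `i + 1`; so the requirement `k ≤ min E` on a set
`E` of positive integers becomes `k ≤ a + 1` for all `a ∈ E`. -/

/-! ### Finite sets of positive integers -/

/-- `E₁ < E₂ < ⋯` : consecutive finite sets (empty sets are allowed). -/
def Successive {ι : Type*} [LT ι] (E : ι → Finset ℕ) : Prop :=
  ∀ i j, i < j → ∀ a ∈ E i, ∀ b ∈ E j, a < b

/-- The set `{min E₁, …, min E_k}`. -/
noncomputable def minSet {k : ℕ} (E : Fin k → Finset ℕ) : Finset ℕ :=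
  Finset.univ.image fun i => sInf (E i : Set ℕ)

/-- A family `E₁ < ⋯ < E_k` of nonempty finite sets is `𝓕`-admissible if
`{min E₁, …, min E_k} ∈ 𝓕`. -/
def Admissible (𝓕 : Set (Finset ℕ)) {k : ℕ} (E : Fin k → Finset ℕ) : Prop :=
  (∀ i, (E i).Nonempty) ∧ Successive E ∧ minSet E ∈ 𝓕

/-- `𝓕[𝓖]`: unions of the `𝓕`-admissible families of members of `𝓖`. -/
def familyComp (𝓕 𝓖 : Set (Finset ℕ)) : Set (Finset ℕ) :=
  {F | ∃ (k : ℕ) (G : Fin k → Finset ℕ),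
    Admissible 𝓕 G ∧ (∀ i, G i ∈ 𝓖) ∧ F = Finset.univ.biUnion G}

/-- `𝓢₀`: singletons and the empty set. -/
def schreierZero : Set (Finset ℕ) := {F | F.card ≤ 1}

/-- `𝓢₁`: the sets `F` of positive integers with `|F| ≤ min F`, and the empty set. -/
def schreierOne : Set (Finset ℕ) := {F | ∀ a ∈ F, F.card ≤ a + 1}

/-- A choice, for every countable limit ordinal `α`, of a sequence `αₙ ↑ α` of smaller ordinals. -/
structure LimitChoice where
  seq : Ordinal.{0} → ℕ → Ordinal.{0}
  monotone : ∀ α < ω₁, Order.IsSuccLimit α → Monotone (seq α)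
  lt : ∀ α < ω₁, Order.IsSuccLimit α → ∀ n, seq α n < α
  cofinal : ∀ α < ω₁, Order.IsSuccLimit α → ∀ β < α, ∃ n, β < seq α n

theorem LimitChoice.nonempty : Nonempty LimitChoice := by
  have h : ∀ α : Ordinal.{0}, ∃ s : ℕ → Ordinal.{0}, α < ω₁ → Order.IsSuccLimit α →
      Monotone s ∧ (∀ n, s n < α) ∧ ∀ β < α, ∃ n, β < s n := by
    intro α
    by_cases hα : α < ω₁ ∧ Order.IsSuccLimit α
    · obtain ⟨h1, h2⟩ := hα
      have hc : Countable (Set.Iio α) := by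
        rw [← Cardinal.mk_le_aleph0_iff, Cardinal.mk_Iio_ordinal, Cardinal.lift_le_aleph0,
          ← Order.lt_succ_iff, Cardinal.succ_aleph0, ← Cardinal.lt_ord, Cardinal.ord_aleph]
        exact h1
      have hn : Nonempty (Set.Iio α) := ⟨⟨0, h2.bot_lt⟩⟩
      obtain ⟨s, hs, ht⟩ := Filter.exists_seq_monotone_tendsto_atTop_atTop (Set.Iio α)
      refine ⟨fun n => s n, fun _ _ => ⟨fun i j hij => hs hij, fun n => (s n).2, ?_⟩⟩
      intro β hβ
      obtain ⟨n, hn⟩ := (ht.eventually_ge_atTop ⟨Order.succ β, h2.succ_lt hβ⟩).exists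
      exact ⟨n, (Order.lt_succ β).trans_le hn⟩
    · exact ⟨fun _ => 0, fun h1 h2 => (hα ⟨h1, h2⟩).elim⟩
  choose s hs using h
  exact ⟨⟨s, fun α h1 h2 => (hs α h1 h2).1, fun α h1 h2 => (hs α h1 h2).2.1,
    fun α h1 h2 => (hs α h1 h2).2.2⟩⟩

/-- The Schreier families `𝓢_α` (for `α < ω₁`) built from the choice `L`:
`𝓢_{α+1} = 𝓢₁[𝓢_α]`, and for a limit `α`, `F ∈ 𝓢_α` iff for some `n`, `F ∈ 𝓢_{αₙ}` and `n ≤ F`.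
(With indices from `0`, the last inequality is again `n ≤ a` for all `a ∈ F`.) -/
noncomputable def schreier (L : LimitChoice) (α : Ordinal.{0}) : Set (Finset ℕ) :=
  Ordinal.limitRecOn (motive := fun _ => Set (Finset ℕ)) α
    schreierZero
    (fun _ S => familyComp schreierOne S)
    (fun β _ S => {F | ∃ (n : ℕ) (h : L.seq β n < β), F ∈ S (L.seq β n) h ∧ ∀ a ∈ F, n ≤ a})

/-! ### Tsirelson's space -/

/-- `n ≤ E₁ < ⋯ < Eₙ`. -/
def TsirelsonFamily {n : ℕ} (E : Fin n → Finset ℕ) : Prop :=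
  Successive E ∧ ∀ i, ∀ a ∈ E i, n ≤ a + 1

/-- The restriction `E x` of a finitely supported sequence `x` to `E`. -/
def restr (E : Finset ℕ) (x : ℕ →₀ ℝ) : ℕ →₀ ℝ := x.filter (· ∈ E)

/-- The increasing approximations of the Tsirelson norm: `‖x‖₀ = ‖x‖_∞` and
`‖x‖ₘ₊₁ = max (‖x‖ₘ, sup {½ ∑ᵢ ‖Eᵢ x‖ₘ : n ≤ E₁ < ⋯ < Eₙ})`. -/
noncomputable def tsNormAux : ℕ → (ℕ →₀ ℝ) → ℝ≥0∞
  | 0, x => ⨆ i, ‖x i‖ₑ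
  | m + 1, x => max (tsNormAux m x)
      (⨆ (n : ℕ) (E : Fin n → Finset ℕ) (_ : TsirelsonFamily E),
        2⁻¹ * ∑ i, tsNormAux m (restr (E i) x))

/-- The Tsirelson norm on `c₀₀`, as the limit of its approximations, with values in `[0, ∞]`. -/
noncomputable def tsENorm (x : ℕ →₀ ℝ) : ℝ≥0∞ := ⨆ m, tsNormAux m x

/-- The Tsirelson norm on `c₀₀`; see `tsNorm_implicit` for the implicit equation. -/
noncomputable def tsNorm (x : ℕ →₀ ℝ) : ℝ := (tsENorm x).toReal

theorem restr_add (E : Finset ℕ) (x y : ℕ →₀ ℝ) : restr E (x + y) = restr E x + restr E y :=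
  Finsupp.filter_add

theorem restr_smul (E : Finset ℕ) (c : ℝ) (x : ℕ →₀ ℝ) : restr E (c • x) = c • restr E x :=
  Finsupp.filter_smul

theorem tsNormAux_mono (x : ℕ →₀ ℝ) : Monotone fun m => tsNormAux m x :=
  monotone_nat_of_le_succ fun m => by rw [tsNormAux]; exact le_max_left _ _

theorem tsNormAux_add (m : ℕ) (x y : ℕ →₀ ℝ) :
    tsNormAux m (x + y) ≤ tsNormAux m x + tsNormAux m y := by
  induction m generalizing x y with
  | zero =>
    simp only [tsNormAux]
    refine iSup_le fun i => ?_
    rw [Finsupp.add_apply]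
    exact (enorm_add_le _ _).trans
      (add_le_add (le_iSup (fun i => ‖x i‖ₑ) i) (le_iSup (fun i => ‖y i‖ₑ) i))
  | succ m ih =>
    simp only [tsNormAux]
    refine max_le ((ih x y).trans (add_le_add (le_max_left _ _) (le_max_left _ _))) ?_
    refine iSup_le fun n => iSup_le fun E => iSup_le fun hE => ?_
    have key : ∀ z : ℕ →₀ ℝ, 2⁻¹ * ∑ i, tsNormAux m (restr (E i) z) ≤
        max (tsNormAux m z) (⨆ (n : ℕ) (E : Fin n → Finset ℕ) (_ : TsirelsonFamily E),
          2⁻¹ * ∑ i, tsNormAux m (restr (E i) z)) := fun z =>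
      le_max_of_le_right (le_iSup_of_le n (le_iSup_of_le E (le_iSup_of_le hE le_rfl)))
    refine le_trans ?_ (add_le_add (key x) (key y))
    rw [← mul_add, ← Finset.sum_add_distrib]
    gcongr with i
    rw [restr_add]
    exact ih _ _

theorem tsNormAux_smul_le (m : ℕ) (c : ℝ) (x : ℕ →₀ ℝ) :
    tsNormAux m (c • x) ≤ ‖c‖ₑ * tsNormAux m x := by
  induction m generalizing x with
  | zero =>
    simp only [tsNormAux]
    refine iSup_le fun i => ?_
    rw [Finsupp.smul_apply, smul_eq_mul, enorm_mul]
    gcongr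
    exact le_iSup (fun i => ‖x i‖ₑ) i
  | succ m ih =>
    simp only [tsNormAux]
    refine max_le ((ih x).trans (by gcongr; exact le_max_left _ _)) ?_
    refine iSup_le fun n => iSup_le fun E => iSup_le fun hE => ?_
    calc 2⁻¹ * ∑ i, tsNormAux m (restr (E i) (c • x))
        ≤ 2⁻¹ * ∑ i, ‖c‖ₑ * tsNormAux m (restr (E i) x) := by
          gcongr with i
          rw [restr_smul]
          exact ih _
      _ = ‖c‖ₑ * (2⁻¹ * ∑ i, tsNormAux m (restr (E i) x)) := by
          rw [← Finset.mul_sum]; ring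
      _ ≤ _ := by
          gcongr
          exact le_max_of_le_right
            (le_iSup_of_le n (le_iSup_of_le E (le_iSup_of_le hE le_rfl)))

theorem tsNormAux_le_sum (m : ℕ) (x : ℕ →₀ ℝ) (s : Finset ℕ) (hs : x.support ⊆ s) :
    tsNormAux m x ≤ ∑ j ∈ s, ‖x j‖ₑ := by
  induction m generalizing x with
  | zero =>
    simp only [tsNormAux]
    refine iSup_le fun i => ?_
    by_cases hi : i ∈ s
    · exact Finset.single_le_sum (f := fun j => ‖x j‖ₑ) (fun _ _ => zero_le) hi
    · have : x i = 0 := by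
        by_contra h
        exact hi (hs (Finsupp.mem_support_iff.2 h))
      simp [this]
  | succ m ih =>
    simp only [tsNormAux]
    refine max_le (ih x hs) ?_
    refine iSup_le fun n => iSup_le fun E => iSup_le fun hE => ?_
    have h1 : ∀ i, tsNormAux m (restr (E i) x) ≤ ∑ j ∈ s, if j ∈ E i then ‖x j‖ₑ else 0 := by
      intro i
      refine (ih (restr (E i) x) ?_).trans (Finset.sum_le_sum fun j _ => ?_)
      · rw [restr, Finsupp.support_filter]
        exact (Finset.filter_subset _ _).trans hs
      · rw [restr, Finsupp.filter_apply]
        split_ifs <;> simp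
    have h2 : ∀ j, (∑ i, if j ∈ E i then ‖x j‖ₑ else 0) ≤ ‖x j‖ₑ := by
      intro j
      by_cases hj : ∃ i, j ∈ E i
      · obtain ⟨i, hi⟩ := hj
        rw [Finset.sum_eq_single i]
        · simp [hi]
        · intro k _ hk
          rw [if_neg]
          intro hkj
          rcases lt_or_gt_of_ne hk with h | h
          · exact lt_irrefl _ (hE.1 k i h j hkj j hi)
          · exact lt_irrefl _ (hE.1 i k h j hi j hkj)
        · simp
      · push Not at hj
        simp [hj]
    calc 2⁻¹ * ∑ i, tsNormAux m (restr (E i) x)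
        ≤ 1 * ∑ i, ∑ j ∈ s, if j ∈ E i then ‖x j‖ₑ else 0 := by
          gcongr with i
          · exact ENNReal.inv_le_one.2 one_le_two
          · exact h1 i
      _ ≤ ∑ j ∈ s, ‖x j‖ₑ := by
          rw [one_mul, Finset.sum_comm]
          exact Finset.sum_le_sum fun j _ => h2 j

theorem tsENorm_ne_top (x : ℕ →₀ ℝ) : tsENorm x ≠ ∞ := by
  have h : tsENorm x ≤ ∑ j ∈ x.support, ‖x j‖ₑ :=
    iSup_le fun m => tsNormAux_le_sum m x _ subset_rfl
  exact ne_top_of_le_ne_top (by simp) h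

theorem enorm_apply_le_tsENorm (x : ℕ →₀ ℝ) (i : ℕ) : ‖x i‖ₑ ≤ tsENorm x :=
  (le_iSup (fun i => ‖x i‖ₑ) i).trans (le_iSup (fun m => tsNormAux m x) 0)

theorem tsENorm_add (x y : ℕ →₀ ℝ) : tsENorm (x + y) ≤ tsENorm x + tsENorm y :=
  iSup_le fun m => (tsNormAux_add m x y).trans
    (add_le_add (le_iSup (fun m => tsNormAux m x) m) (le_iSup (fun m => tsNormAux m y) m))

theorem tsENorm_smul_le (c : ℝ) (x : ℕ →₀ ℝ) : tsENorm (c • x) ≤ ‖c‖ₑ * tsENorm x :=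
  iSup_le fun m => (tsNormAux_smul_le m c x).trans
    (by gcongr; exact le_iSup (fun m => tsNormAux m x) m)

theorem tsENorm_smul (c : ℝ) (x : ℕ →₀ ℝ) : tsENorm (c • x) = ‖c‖ₑ * tsENorm x := by
  refine le_antisymm (tsENorm_smul_le c x) ?_
  rcases eq_or_ne c 0 with rfl | hc
  · simp
  · have h := tsENorm_smul_le c⁻¹ (c • x)
    rw [smul_smul, inv_mul_cancel₀ hc, one_smul] at h
    calc ‖c‖ₑ * tsENorm x ≤ ‖c‖ₑ * (‖c⁻¹‖ₑ * tsENorm (c • x)) := by gcongr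
      _ = tsENorm (c • x) := by
        rw [← mul_assoc, ← enorm_mul, mul_inv_cancel₀ hc]; simp

theorem tsENorm_implicit (x : ℕ →₀ ℝ) :
    tsENorm x = max (⨆ i, ‖x i‖ₑ)
      (⨆ (n : ℕ) (E : Fin n → Finset ℕ) (_ : TsirelsonFamily E),
        2⁻¹ * ∑ i, tsENorm (restr (E i) x)) := by
  apply le_antisymm
  · refine iSup_le fun m => ?_
    induction m with
    | zero => exact le_max_left _ _
    | succ m ih =>
      rw [tsNormAux]
      refine max_le ih (le_max_of_le_right ?_)
      gcongr with n E hE i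
      exact le_iSup (fun m => tsNormAux m _) m
  · refine max_le (iSup_le fun i => enorm_apply_le_tsENorm x i) ?_
    refine iSup_le fun n => iSup_le fun E => iSup_le fun hE => ?_
    simp only [tsENorm]
    rw [ENNReal.finsetSum_iSup_of_monotone fun i => tsNormAux_mono _, ENNReal.mul_iSup]
    refine iSup_le fun m => le_iSup_of_le (m + 1) ?_
    rw [tsNormAux]
    exact le_max_of_le_right (le_iSup_of_le n (le_iSup_of_le E (le_iSup_of_le hE le_rfl)))

theorem abs_apply_le_tsNorm (x : ℕ →₀ ℝ) (i : ℕ) : |x i| ≤ tsNorm x := by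
  have h := ENNReal.toReal_mono (tsENorm_ne_top x) (enorm_apply_le_tsENorm x i)
  simpa [tsNorm] using h

theorem tsNorm_add (x y : ℕ →₀ ℝ) : tsNorm (x + y) ≤ tsNorm x + tsNorm y := by
  unfold tsNorm
  rw [← ENNReal.toReal_add (tsENorm_ne_top _) (tsENorm_ne_top _)]
  exact ENNReal.toReal_mono (by simp [tsENorm_ne_top]) (tsENorm_add _ _)

theorem tsNorm_smul (c : ℝ) (x : ℕ →₀ ℝ) : tsNorm (c • x) = |c| * tsNorm x := by
  unfold tsNorm
  rw [tsENorm_smul, ENNReal.toReal_mul]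
  simp

/-- The implicit equation of Tsirelson's norm. -/
theorem tsNorm_implicit (x : ℕ →₀ ℝ) :
    IsLUB ({r | ∃ i, r = |x i|} ∪
      {r | ∃ (n : ℕ) (E : Fin n → Finset ℕ), TsirelsonFamily E ∧
        r = 1 / 2 * ∑ i, tsNorm (restr (E i) x)}) (tsNorm x) := by
  have hsum : ∀ (n : ℕ) (E : Fin n → Finset ℕ), 1 / 2 * ∑ i, tsNorm (restr (E i) x) =
      (2⁻¹ * ∑ i, tsENorm (restr (E i) x)).toReal := by
    intro n E
    rw [ENNReal.toReal_mul, ENNReal.toReal_sum fun i _ => tsENorm_ne_top _]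
    simp [tsNorm]
  have hfin : ∀ (n : ℕ) (E : Fin n → Finset ℕ), 2⁻¹ * ∑ i, tsENorm (restr (E i) x) ≠ ∞ :=
    fun n E => ENNReal.mul_ne_top (by simp) (by simp [tsENorm_ne_top])
  constructor
  · rintro r (⟨i, rfl⟩ | ⟨n, E, hE, rfl⟩)
    · exact abs_apply_le_tsNorm x i
    · rw [hsum]
      refine ENNReal.toReal_mono (tsENorm_ne_top x) ?_
      conv_rhs => rw [tsENorm_implicit]
      exact le_max_of_le_right (le_iSup_of_le n (le_iSup_of_le E (le_iSup_of_le hE le_rfl)))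
  · intro B hB
    have hB0 : 0 ≤ B := (abs_nonneg _).trans (hB (Or.inl ⟨0, rfl⟩))
    refine ENNReal.toReal_le_of_le_ofReal hB0 ?_
    rw [tsENorm_implicit]
    refine max_le (iSup_le fun i => ?_) (iSup_le fun n => iSup_le fun E => iSup_le fun hE => ?_)
    · rw [← ofReal_norm]
      exact ENNReal.ofReal_le_ofReal (hB (Or.inl ⟨i, rfl⟩))
    · rw [← ENNReal.ofReal_toReal (hfin n E), ← hsum]
      exact ENNReal.ofReal_le_ofReal (hB (Or.inr ⟨n, E, hE, rfl⟩))

/-- The space `c₀₀` of finitely supported real sequences, to be given the Tsirelson norm. -/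
def C00 : Type := ℕ →₀ ℝ

noncomputable instance : AddCommGroup C00 := inferInstanceAs (AddCommGroup (ℕ →₀ ℝ))

noncomputable instance : Module ℝ C00 := inferInstanceAs (Module ℝ (ℕ →₀ ℝ))

/-- A finitely supported sequence, seen as an element of the space with the Tsirelson norm. -/
noncomputable def C00.of : (ℕ →₀ ℝ) ≃ₗ[ℝ] C00 := LinearEquiv.refl ℝ (ℕ →₀ ℝ)

noncomputable instance : Norm C00 := ⟨fun x => tsNorm (C00.of.symm x)⟩

theorem C00.norm_def (x : C00) : ‖x‖ = tsNorm (C00.of.symm x) := rfl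

theorem C00.normedSpaceCore : NormedSpace.Core ℝ C00 where
  norm_nonneg _ := ENNReal.toReal_nonneg
  norm_smul c x := by
    rw [C00.norm_def, C00.norm_def, map_smul, tsNorm_smul, Real.norm_eq_abs]
  norm_triangle x y := by
    rw [C00.norm_def, C00.norm_def, C00.norm_def, map_add]
    exact tsNorm_add _ _
  norm_eq_zero_iff x := by
    rw [C00.norm_def]
    constructor
    · intro h
      rw [← C00.of.symm.map_eq_zero_iff]
      refine Finsupp.ext fun i => ?_
      have h1 := abs_apply_le_tsNorm (C00.of.symm x) i
      rw [h] at h1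
      exact abs_nonpos_iff.1 h1
    · rintro rfl
      have h := tsNorm_smul 0 0
      rw [map_zero]
      simpa using h

noncomputable instance : NormedAddCommGroup C00 := NormedAddCommGroup.ofCore C00.normedSpaceCore

noncomputable instance : NormedSpace ℝ C00 := NormedSpace.ofCore C00.normedSpaceCore

/-- Tsirelson's space `T`: the completion of `c₀₀` under the Tsirelson norm. -/
abbrev Tsirelson : Type := UniformSpace.Completion C00

/-- The unit vector basis of `T`. -/
noncomputable def tsBasis (i : ℕ) : Tsirelson :=
  UniformSpace.Completion.coe' (C00.of (Finsupp.single i 1))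

/-! ### Block bases -/

section
variable {V : Type*} [AddCommGroup V] [Module ℝ V]

/-- `y` is a block basis of `x`: nonzero, consecutively supported finite linear combinations of the
vectors `xⱼ`. -/
def IsBlockBasis (x y : ℕ → V) : Prop :=
  ∃ b : ℕ → ℕ →₀ ℝ, (∀ i, b i ≠ 0) ∧ Successive (fun i => (b i).support) ∧
    ∀ i, y i = Finsupp.linearCombination ℝ x (b i)

/-- `|·|` is a norm equivalent to `‖·‖`. -/
def IsEquivalentNorm {X : Type*} [NormedAddCommGroup X] [NormedSpace ℝ X]
    (p : Seminorm ℝ X) : Prop :=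
  ∃ c C : ℝ, 0 < c ∧ ∀ v, c * ‖v‖ ≤ p v ∧ p v ≤ C * ‖v‖

/-! ### Asymptotic constants and the `Δ`-spectrum

In these definitions `x` is a basic sequence for the norm `p`. -/

/-- `δ_𝓕(x)` for the norm `p`: the supremum of the `δ ≥ 0` such that `p (∑ yᵢ) ≥ δ ∑ p (yᵢ)` for
all finite block sequences `y₁, …, y_k` of `x` that are `𝓕`-admissible with respect to `x`. -/
noncomputable def asympConst (p : Seminorm ℝ V) (𝓕 : Set (Finset ℕ)) (x : ℕ → V) : ℝ :=
  sSup {δ : ℝ | 0 ≤ δ ∧ ∀ (k : ℕ) (b : Fin k → ℕ →₀ ℝ),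
    Admissible 𝓕 (fun i => (b i).support) →
      δ * ∑ i, p (Finsupp.linearCombination ℝ x (b i)) ≤
        p (∑ i, Finsupp.linearCombination ℝ x (b i))}

/-- `x` `Δ`-stabilizes `γ = (γ_α)_{α < ω₁}` for the norm `p`. -/
def DeltaStabilizes (L : LimitChoice) (p : Seminorm ℝ V) (x : ℕ → V)
    (γ : Set.Iio (ω₁ : Ordinal.{0}) → ℝ) : Prop :=
  ∃ ε : ℕ → ℝ, Antitone ε ∧ Filter.Tendsto ε Filter.atTop (nhds 0) ∧
    ∀ α : Set.Iio (ω₁ : Ordinal.{0}), ∃ m : ℕ, ∀ n ≥ m, ∀ y : ℕ → V,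
      IsBlockBasis (fun i => x (n + i)) y →
        |asympConst p (schreier L (α : Ordinal.{0})) y - γ α| < ε n

/-- The `Δ`-spectrum, for the norm `p`, of the space with basis `x`. -/
def deltaSpectrum (L : LimitChoice) (p : Seminorm ℝ V) (x : ℕ → V) :
    Set (Set.Iio (ω₁ : Ordinal.{0}) → ℝ) :=
  {γ | ∃ y, IsBlockBasis x y ∧ DeltaStabilizes L p y γ}

end

/-! ### Distortion -/

/-- The distortion `d(X, |·|)`: the infimum over the closed infinite-dimensional subspaces `Y` of
`X` of the supremum of `|u| / |v|` over `u, v` in the `‖·‖`-unit sphere of `Y`. -/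
noncomputable def distortion {X : Type*} [NormedAddCommGroup X] [NormedSpace ℝ X]
    (p : Seminorm ℝ X) : ℝ≥0∞ :=
  ⨅ (Y : Submodule ℝ X) (_ : IsClosed (Y : Set X)) (_ : ¬ FiniteDimensional ℝ Y),
    ⨆ (u ∈ Y) (v ∈ Y) (_ : ‖u‖ = 1) (_ : ‖v‖ = 1), ENNReal.ofReal (p u / p v)

/-- The closed linear span `[xᵢ]` of a sequence in `T`. -/
noncomputable abbrev closedSpan (x : ℕ → Tsirelson) : Submodule ℝ Tsirelson :=
  (Submodule.span ℝ (Set.range x)).topologicalClosure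

/-- The sequence `x`, seen inside its closed linear span. -/
noncomputable def inClosedSpan (x : ℕ → Tsirelson) (i : ℕ) : closedSpan x :=
  ⟨x i, Submodule.le_topologicalClosure _ (Submodule.subset_span (Set.mem_range_self i))⟩

/-! Pass to a block sequence $(z_i)$ on whose tails $\delta_1$ is as close to $1/2$ from below as
desired. Choose a scale $S$ such that $p\le 2S\|\cdot\|$ on some tail, while vectors with $\|v\|=1$
and $p(v)\ge S$ exist arbitrarily far out (`exists_threshold`). Let $(u_i)$ be a very sparse block
sequence of such vectors. The upper estimate holds on its span, and it remains to show
$S\|\cdot\|\le 16p$ there; then the distortion is at most $32$, whatever the equivalence constants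
of $p$.

The lower estimate holds because each unfolding of the Tsirelson norm costs a factor $1/2$, which
$p$ recovers from its almost-$1/2$ lower $\ell_1$-estimate. The obstacle is that Tsirelson
admissibility refers to $(e_i)$, whereas the estimate for $p$ needs few pieces compared with their
position along $(z_i)$. Let $u_s$ be the first block met by $E_1<\dots<E_n$. Then $n$ is bounded in
terms of $\operatorname{supp}u_s$, so by sparseness a number of pieces proportional to $n$ is
admissible for $p$ beyond $u_s$. The block $u_s$ itself is set aside and costs at most $S|a_s|$.
Hence the invariant, with $q(a)=p(\sum a_iu_i)$, $$S\Big\|\sum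
a_iu_i\Big\|_m\le\max_s\big(S|a_s|+M_s\,q(a_{>s})\big),$$ proved by induction on $m$ in
`mul_tsAux_le`. The weights $M_s\downarrow 2$ absorb the gaps between the constants and $1/2$.
Blocks cut by several $E_j$ are treated in `exists_split_of_fibre`, and `mul_tsNorm_le` fixes the
constants. -/

/-! ### The approximations of the Tsirelson norm, with real values -/

/-- The approximation `‖·‖ₘ` of the Tsirelson norm, as a real number. -/
noncomputable def tsAux (m : ℕ) (x : ℕ →₀ ℝ) : ℝ := (tsNormAux m x).toReal

theorem tsNormAux_le_tsENorm (m : ℕ) (x : ℕ →₀ ℝ) : tsNormAux m x ≤ tsENorm x :=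
  le_iSup (fun m => tsNormAux m x) m

theorem tsNormAux_ne_top (m : ℕ) (x : ℕ →₀ ℝ) : tsNormAux m x ≠ ∞ :=
  ne_top_of_le_ne_top (tsENorm_ne_top x) (tsNormAux_le_tsENorm m x)

theorem tsAux_nonneg (m : ℕ) (x : ℕ →₀ ℝ) : 0 ≤ tsAux m x := ENNReal.toReal_nonneg

theorem tsAux_le_tsNorm (m : ℕ) (x : ℕ →₀ ℝ) : tsAux m x ≤ tsNorm x :=
  ENNReal.toReal_mono (tsENorm_ne_top x) (tsNormAux_le_tsENorm m x)

theorem tsNorm_le_of_tsAux_le {x : ℕ →₀ ℝ} {B : ℝ} (hB : 0 ≤ B) (h : ∀ m, tsAux m x ≤ B) :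
    tsNorm x ≤ B :=
  ENNReal.toReal_le_of_le_ofReal hB <| iSup_le fun m =>
    (ENNReal.le_ofReal_iff_toReal_le (tsNormAux_ne_top m x) hB).2 (h m)

theorem tsAux_zero_le {x : ℕ →₀ ℝ} {B : ℝ} (hB : 0 ≤ B) (h : ∀ i, |x i| ≤ B) :
    tsAux 0 x ≤ B := by
  refine ENNReal.toReal_le_of_le_ofReal hB (iSup_le fun i => ?_)
  rw [← ofReal_norm]
  exact ENNReal.ofReal_le_ofReal (h i)

theorem tsAux_succ_le {m : ℕ} {x : ℕ →₀ ℝ} {B : ℝ} (hB : 0 ≤ B) (h : tsAux m x ≤ B)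
    (hE : ∀ (n : ℕ) (E : Fin n → Finset ℕ), TsirelsonFamily E →
      1 / 2 * ∑ i, tsAux m (restr (E i) x) ≤ B) : tsAux (m + 1) x ≤ B := by
  refine ENNReal.toReal_le_of_le_ofReal hB ?_
  rw [tsNormAux]
  refine max_le ((ENNReal.le_ofReal_iff_toReal_le (tsNormAux_ne_top m x) hB).2 h)
    (iSup_le fun n => iSup_le fun E => iSup_le fun hF => ?_)
  have hfin : 2⁻¹ * ∑ i, tsNormAux m (restr (E i) x) ≠ ∞ :=
    ENNReal.mul_ne_top (by simp) (by simp [tsNormAux_ne_top])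
  refine (ENNReal.le_ofReal_iff_toReal_le hfin hB).2 ((le_of_eq ?_).trans (hE n E hF))
  rw [ENNReal.toReal_mul, ENNReal.toReal_sum fun i _ => tsNormAux_ne_top _ _]
  simp [tsAux]

theorem tsAux_add (m : ℕ) (x y : ℕ →₀ ℝ) : tsAux m (x + y) ≤ tsAux m x + tsAux m y := by
  unfold tsAux
  rw [← ENNReal.toReal_add (tsNormAux_ne_top _ _) (tsNormAux_ne_top _ _)]
  exact ENNReal.toReal_mono (by simp [tsNormAux_ne_top]) (tsNormAux_add _ _ _)

theorem tsAux_zero_right (m : ℕ) : tsAux m 0 = 0 := by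
  have h := tsNormAux_le_sum m 0 ∅ (by simp)
  simp only [Finset.sum_empty, nonpos_iff_eq_zero] at h
  simp [tsAux, h]

theorem tsAux_sum {ι : Type*} (m : ℕ) (s : Finset ι) (f : ι → ℕ →₀ ℝ) :
    tsAux m (∑ i ∈ s, f i) ≤ ∑ i ∈ s, tsAux m (f i) :=
  Finset.le_sum_of_subadditive _ (tsAux_zero_right m).le (tsAux_add m) s f

theorem tsNormAux_restr_le (m : ℕ) (A : Finset ℕ) (x : ℕ →₀ ℝ) :
    tsNormAux m (restr A x) ≤ tsNormAux m x := by
  induction m generalizing x with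
  | zero =>
    simp only [tsNormAux]
    gcongr with i
    rw [restr, Finsupp.filter_apply]
    split_ifs <;> simp
  | succ m ih =>
    simp only [tsNormAux]
    refine max_le_max (ih x) ?_
    gcongr with n E hE i
    have : restr (E i) (restr A x) = restr A (restr (E i) x) := by
      ext j
      simp only [restr, Finsupp.filter_apply]
      split_ifs <;> rfl
    rw [this]
    exact ih _

theorem tsAux_restr_le (m : ℕ) (A : Finset ℕ) (x : ℕ →₀ ℝ) :
    tsAux m (restr A x) ≤ tsAux m x :=
  ENNReal.toReal_mono (tsNormAux_ne_top _ _) (tsNormAux_restr_le m A x)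

/-- Applied to a single block: however an admissible family cuts it, the weighted sum stays below
its norm, so no induction is needed there. -/
theorem half_sum_tsAux_le_tsNorm {n : ℕ} {E : Fin n → Finset ℕ} (hE : TsirelsonFamily E) (m : ℕ)
    (x : ℕ →₀ ℝ) : 1 / 2 * ∑ i, tsAux m (restr (E i) x) ≤ tsNorm x := by
  refine le_trans ?_ ((tsNorm_implicit x).1 (Or.inr ⟨n, E, hE, rfl⟩))
  gcongr with i
  exact tsAux_le_tsNorm _ _

theorem sum_le_of_unique {ι : Type*} (s : Finset ι) {f : ι → ℝ} {C : ℝ} (hC : 0 ≤ C)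
    (hf : ∀ i, f i ≤ C) (hu : ∀ i j, f i ≠ 0 → f j ≠ 0 → i = j) : ∑ i ∈ s, f i ≤ C := by
  by_cases h : ∃ i ∈ s, f i ≠ 0
  · obtain ⟨i, hi, hi0⟩ := h
    rw [Finset.sum_eq_single_of_mem i hi fun j _ hj => by
      by_contra h0
      exact hj (hu _ _ h0 hi0)]
    exact hf i
  · push Not at h
    rw [Finset.sum_eq_zero h]
    exact hC

theorem sum_range_three_mul (f : ℕ → ℝ) (N : ℕ) : ∑ l ∈ Finset.range (3 * N), f l =
    ∑ l ∈ Finset.range N, (f (3 * l) + f (3 * l + 1) + f (3 * l + 2)) := by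
  induction N with
  | zero => simp
  | succ N ih =>
    rw [Finset.sum_range_succ, ← ih, show 3 * (N + 1) = 3 * N + 1 + 1 + 1 by ring]
    simp only [Finset.sum_range_succ]
    ring

/-! ### Block sequences with a lower Tsirelson estimate -/

section LowerEstimate

variable {u : ℕ → ℕ →₀ ℝ}

theorem linearCombination_apply_of_mem (hu : Successive fun i => (u i).support) (a : ℕ →₀ ℝ)
    {i e : ℕ} (he : e ∈ (u i).support) :
    Finsupp.linearCombination ℝ u a e = a i * u i e := by
  rw [Finsupp.linearCombination_apply, Finsupp.sum, Finsupp.finsetSum_apply,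
    Finset.sum_eq_single i]
  · simp
  · intro j _ hj
    have : u j e = 0 := by
      by_contra h0
      rw [← ne_eq, ← Finsupp.mem_support_iff] at h0
      rcases lt_or_gt_of_ne hj with h | h
      · exact lt_irrefl _ (hu j i h e h0 e he)
      · exact lt_irrefl _ (hu i j h e he e h0)
    simp [this]
  · intro h
    simp [Finsupp.notMem_support_iff.1 h]

theorem linearCombination_apply_eq_zero {a : ℕ →₀ ℝ} {e : ℕ}
    (h : ∀ i ∈ a.support, e ∉ (u i).support) : Finsupp.linearCombination ℝ u a e = 0 := by
  rw [Finsupp.linearCombination_apply, Finsupp.sum, Finsupp.finsetSum_apply]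
  exact Finset.sum_eq_zero fun i hi => by simp [Finsupp.notMem_support_iff.1 (h i hi)]

theorem restr_linearCombination_eq_zero {a : ℕ →₀ ℝ} {E : Finset ℕ}
    (h : ∀ i ∈ a.support, ∀ e ∈ E, e ∉ (u i).support) :
    restr E (Finsupp.linearCombination ℝ u a) = 0 := by
  ext e
  rw [restr, Finsupp.filter_apply]
  split_ifs with he
  · exact linearCombination_apply_eq_zero fun i hi => h i hi e he
  · rfl

/-- The terms `|aₛ| S + Mₛ q(a_{>s})` that bound the Tsirelson norm of `∑ aᵢ uᵢ`. -/
noncomputable def headTail (S : ℝ) (M : ℕ → ℝ) (q : Seminorm ℝ (ℕ →₀ ℝ)) (a : ℕ →₀ ℝ)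
    (s : ℕ) : ℝ :=
  S * |a s| + M s * q (a.filter (s < ·))

/-- At a point outside the support with no support after it both terms vanish, so only finitely many
indices compete. The maximizer is where a class of blocks gets split. -/
theorem exists_headTail_max {S : ℝ} (hS : 0 ≤ S) {M : ℕ → ℝ} (hM : ∀ s, 0 ≤ M s)
    (q : Seminorm ℝ (ℕ →₀ ℝ)) (a : ℕ →₀ ℝ) (t : ℕ) :
    ∃ s ≥ t, ∀ r ≥ t, headTail S M q a r ≤ headTail S M q a s := by
  have h0 : ∀ r, 0 ≤ headTail S M q a r := fun r =>
    add_nonneg (mul_nonneg hS (abs_nonneg _)) (mul_nonneg (hM r) (apply_nonneg _ _))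
  obtain ⟨s, hs, hmax⟩ := Finset.exists_max_image (insert t (a.support.filter (t ≤ ·) ∪
    Finset.Ico t (a.support.sup id))) (headTail S M q a) ⟨t, Finset.mem_insert_self _ _⟩
  have hst : t ≤ s := by
    simp only [Finset.mem_insert, Finset.mem_union, Finset.mem_filter, Finset.mem_Ico] at hs
    omega
  refine ⟨s, hst, fun r hr => ?_⟩
  by_cases hr' : r ∈ insert t (a.support.filter (t ≤ ·) ∪ Finset.Ico t (a.support.sup id))
  · exact hmax r hr'
  · simp only [Finset.mem_insert, Finset.mem_union, Finset.mem_filter, Finset.mem_Ico,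
      Finsupp.mem_support_iff, not_or, not_and, not_lt] at hr'
    have h1 : a r = 0 := by
      by_contra h
      exact hr'.2.1 h hr
    have h2 : a.filter (r < ·) = 0 := by
      ext i
      rw [Finsupp.filter_apply]
      split_ifs with hi
      · by_contra h
        have := Finset.le_sup (f := id) (Finsupp.mem_support_iff.2 h)
        simp only [id] at this
        have := hr'.2.2 hr
        omega
      · rfl
    have : headTail S M q a r = 0 := by simp [headTail, h1, h2]
    rw [this]
    exact h0 s

/-! ### How a successive family of sets cuts a block sequence. -/

open Classical in
/-- The number of sets of `E` that have started before the block `F`. -/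
noncomputable def startedBefore {n : ℕ} (E : Fin n → Finset ℕ) (F : Finset ℕ) : ℕ :=
  (Finset.univ.filter fun j => ∃ e ∈ E j, ∀ f ∈ F, e ≤ f).sup fun j => (j : ℕ) + 1

open Classical in
/-- The number of sets of `E` that have started before the end of the block `F`. -/
noncomputable def startedWithin {n : ℕ} (E : Fin n → Finset ℕ) (F : Finset ℕ) : ℕ :=
  (Finset.univ.filter fun j => ∃ e ∈ E j, ∃ f ∈ F, e ≤ f).sup fun j => (j : ℕ) + 1

section Started

variable {n : ℕ} {E : Fin n → Finset ℕ} {F G : Finset ℕ}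

theorem startedBefore_le_startedWithin (hF : F.Nonempty) :
    startedBefore E F ≤ startedWithin E F := by
  classical
  refine Finset.sup_mono fun j hj => ?_
  simp only [Finset.mem_filter, Finset.mem_univ, true_and] at hj ⊢
  obtain ⟨e, he, h⟩ := hj
  obtain ⟨f, hf⟩ := hF
  exact ⟨e, he, f, hf, h f hf⟩

theorem startedWithin_le_startedBefore (h : ∀ a ∈ F, ∀ b ∈ G, a < b) :
    startedWithin E F ≤ startedBefore E G := by
  classical
  refine Finset.sup_mono fun j hj => ?_
  simp only [Finset.mem_filter, Finset.mem_univ, true_and] at hj ⊢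
  obtain ⟨e, he, f, hf, hef⟩ := hj
  exact ⟨e, he, fun b hb => hef.trans (h f hf b hb).le⟩

theorem startedWithin_le : startedWithin E F ≤ n :=
  Finset.sup_le fun j _ => j.2

/-- When the two counts agree on a block, these inequalities determine the only set that can meet
it. The counts are one plus the largest started index, so empty sets in the family do no harm. -/
theorem started_of_mem (hE : Successive E) {j : Fin n} {e : ℕ} (he : e ∈ E j) (hF : e ∈ F) :
    startedBefore E F ≤ j + 1 ∧ (j : ℕ) + 1 ≤ startedWithin E F := by
  classical
  constructor
  · refine Finset.sup_le fun i hi => ?_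
    simp only [Finset.mem_filter, Finset.mem_univ, true_and] at hi
    obtain ⟨e', he', h⟩ := hi
    by_contra hlt
    have hji : j < i := by
      rw [Fin.lt_def]
      omega
    have := hE j i hji e he e' he'
    have := h e hF
    omega
  · exact Finset.le_sup (f := fun j : Fin n => (j : ℕ) + 1)
      (by simpa using ⟨e, he, e, hF, le_rfl⟩)

end Started

/-! ### The induction on the depth of the Tsirelson norm. -/

variable {S : ℝ} {M θ : ℕ → ℝ} {q : Seminorm ℝ (ℕ →₀ ℝ)}

/-- The contribution of one class of blocks: either a single block, or blocks met by only one of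
the sets `E j`. -/
theorem exists_split_of_fibre (hS : 0 ≤ S) (hM : Antitone M) (hM2 : ∀ s, 2 ≤ M s)
    (hune : ∀ i, u i ≠ 0) (hu : Successive fun i => (u i).support) (hu1 : ∀ i, tsNorm (u i) ≤ 1)
    (hq : ∀ i r, S * |r| ≤ q (Finsupp.single i r)) {m n t l : ℕ} {E : Fin n → Finset ℕ}
    (hE : TsirelsonFamily E) {a : ℕ →₀ ℝ}
    (hal : ∀ i ∈ a.support,
      startedBefore E (u i).support + startedWithin E (u i).support = l)
    (ih : ∀ B, (∀ s ≥ t, headTail S M q a s ≤ B) →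
      S * tsAux m (Finsupp.linearCombination ℝ u a) ≤ B) :
    ∃ s, S * (1 / 2 * ∑ j, tsAux m (restr (E j) (Finsupp.linearCombination ℝ u a))) ≤
      1 / 2 * M t * (q (a.filter (· < s)) + q (a.filter (· = s)) + q (a.filter (s < ·))) := by
  have hMt := hM2 t
  have hne : ∀ i, (u i).support.Nonempty := fun i => Finsupp.support_nonempty_iff.2 (hune i)
  -- The sum of the two counts strictly increases on passing to or from a block inside which a new
  -- set starts, so such a block is alone in its class.
  by_cases hcut : ∃ i ∈ a.support,
      startedBefore E (u i).support < startedWithin E (u i).support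
  · obtain ⟨i, hi, hlt⟩ := hcut
    have hsingle : a = Finsupp.single i (a i) := by
      rw [← Finsupp.support_subset_singleton]
      intro k hk
      rw [Finset.mem_singleton]
      by_contra hki
      have h1 := hal i hi
      have h2 := hal k hk
      have h3 := startedBefore_le_startedWithin (E := E) (hne k)
      rcases lt_or_gt_of_ne hki with h | h
      · have : startedWithin E (u k).support ≤ startedBefore E (u i).support :=
          startedWithin_le_startedBefore (hu k i h)
        omega
      · have : startedWithin E (u i).support ≤ startedBefore E (u k).support :=
          startedWithin_le_startedBefore (hu i k h)
        omega
    refine ⟨i, ?_⟩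
    have h1 : a.filter (· = i) = Finsupp.single i (a i) := by
      conv_lhs => rw [hsingle]
      exact Finsupp.filter_single_of_pos _ rfl
    -- The factor $1/2$ is used up here, so the bound $S|a_i|\le q$ must fit under $\tfrac12M_t\,q$;
    -- this is why $M\ge 2$ is required.
    have h2 : 1 / 2 * ∑ j, tsAux m (restr (E j) (Finsupp.linearCombination ℝ u a)) ≤ |a i| := by
      refine (half_sum_tsAux_le_tsNorm hE m _).trans ?_
      rw [hsingle, Finsupp.linearCombination_single, tsNorm_smul, Finsupp.single_eq_same]
      exact mul_le_of_le_one_right (abs_nonneg _) (hu1 i)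
    have h3 := hq i (a i)
    have h4 := mul_le_mul_of_nonneg_left h2 hS
    rw [← h1] at h3
    have h5 := apply_nonneg q (a.filter (· < i))
    have h6 := apply_nonneg q (a.filter (i < ·))
    have h7 := apply_nonneg q (a.filter (· = i))
    nlinarith
  · push Not at hcut
    obtain ⟨s, hst, hs⟩ := exists_headTail_max hS (fun s => zero_le_two.trans (hM2 s)) q a t
    refine ⟨s, ?_⟩
    have h1 := ih _ hs
    -- No set starts inside a block of this class, so the label is twice the common count and at
    -- most one $E_j$ contributes.
    have h2 : ∑ j, tsAux m (restr (E j) (Finsupp.linearCombination ℝ u a)) ≤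
        tsAux m (Finsupp.linearCombination ℝ u a) := by
      have key : ∀ j, tsAux m (restr (E j) (Finsupp.linearCombination ℝ u a)) ≠ 0 →
          2 * ((j : ℕ) + 1) = l := by
        intro j hj
        by_contra hjl
        apply hj
        rw [restr_linearCombination_eq_zero, tsAux_zero_right]
        intro i hi e he heu
        have h3 := started_of_mem hE.1 he heu
        have h4 := hcut i hi
        have h5 := hal i hi
        omega
      refine sum_le_of_unique _ (tsAux_nonneg _ _) (fun j => tsAux_restr_le _ _ _) ?_
      intro i j hi hj
      have := key i hi
      have := key j hj
      exact Fin.ext (by omega)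
    have h3 : S * |a s| ≤ q (a.filter (· = s)) := by
      have : a.filter (· = s) = Finsupp.single s (a s) := by
        ext i
        rw [Finsupp.filter_apply, Finsupp.single_apply]
        by_cases h : i = s
        · simp [h]
        · simp [h, Ne.symm h]
      rw [this]
      exact hq s _
    have h4 : M s * q (a.filter (s < ·)) ≤ M t * q (a.filter (s < ·)) :=
      mul_le_mul_of_nonneg_right (hM hst) (apply_nonneg _ _)
    have h5 := mul_le_mul_of_nonneg_left h2 hS
    have h6 := apply_nonneg q (a.filter (· < s))
    have h7 := apply_nonneg q (a.filter (· = s))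
    unfold headTail at h1
    nlinarith

theorem filter_headTail_decomp (a : ℕ →₀ ℝ) (s : ℕ) :
    a = a.filter (· < s) + (Finsupp.single s (a s) + a.filter (s < ·)) := by
  ext i
  simp only [Finsupp.add_apply, Finsupp.filter_apply, Finsupp.single_apply]
  rcases lt_trichotomy i s with h | h | h
  · simp [h, h.ne', h.le]
  · simp [h]
  · simp [h, h.ne, h.le]

theorem sum_filter_label (a : ℕ →₀ ℝ) {lab : ℕ → ℕ} {K : ℕ} (h : ∀ i, lab i < K) :
    ∑ l ∈ Finset.range K, a.filter (fun i => lab i = l) = a := by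
  ext i
  rw [Finsupp.finsetSum_apply]
  simp [Finsupp.filter_apply, h i]

/-- If the seminorm `q` satisfies lower `ℓ₁`-estimates with constants close to `1 / 2` on families
of successive intervals whose size is controlled by the supports of the `uᵢ`, then it dominates
the Tsirelson norm of `∑ aᵢ uᵢ`. -/
theorem mul_tsAux_le (hS : 0 ≤ S) (hM : Antitone M) (hM2 : ∀ s, 2 ≤ M s)
    (hMθ : ∀ s, 1 / 2 * M (s + 1) ≤ M s * θ s)
    (hune : ∀ i, u i ≠ 0) (hu : Successive fun i => (u i).support) (hu1 : ∀ i, tsNorm (u i) ≤ 1)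
    (hq : ∀ i r, S * |r| ≤ q (Finsupp.single i r))
    (hθ : ∀ s, ∀ e ∈ (u s).support, ∀ K ≤ 6 * e + 9, ∀ lab : ℕ → ℕ, Monotone lab →
      (∀ i, lab i < K) → ∀ a : ℕ →₀ ℝ, (∀ i ∈ a.support, s < i) →
      θ s * ∑ l ∈ Finset.range K, q (a.filter fun i => lab i = l) ≤ q a)
    (m : ℕ) (a : ℕ →₀ ℝ) (t : ℕ) (hat : ∀ i ∈ a.support, t ≤ i) (B : ℝ)
    (hB : ∀ s ≥ t, headTail S M q a s ≤ B) :
    S * tsAux m (Finsupp.linearCombination ℝ u a) ≤ B := by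
  have hM0 : ∀ s, 0 ≤ M s := fun s => zero_le_two.trans (hM2 s)
  have hne : ∀ i, (u i).support.Nonempty := fun i => Finsupp.support_nonempty_iff.2 (hune i)
  have hB0 : 0 ≤ B := le_trans (add_nonneg (mul_nonneg hS (abs_nonneg _))
    (mul_nonneg (hM0 t) (apply_nonneg _ _))) (hB t le_rfl)
  rcases hS.eq_or_lt with rfl | hSpos
  · simpa using hB0
  induction m generalizing a t B with
  | zero =>
    rw [← le_div_iff₀' hSpos]
    refine tsAux_zero_le (div_nonneg hB0 hS) fun e => ?_
    rw [le_div_iff₀' hSpos]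
    by_cases h : ∃ i ∈ a.support, e ∈ (u i).support
    · obtain ⟨i, hi, he⟩ := h
      rw [linearCombination_apply_of_mem hu a he, abs_mul]
      have h1 := (abs_apply_le_tsNorm (u i) e).trans (hu1 i)
      have h2 := hB i (hat i hi)
      have h3 : 0 ≤ M i * q (a.filter (i < ·)) := mul_nonneg (hM0 i) (apply_nonneg _ _)
      have h4 : |a i| * |u i e| ≤ |a i| := mul_le_of_le_one_right (abs_nonneg _) h1
      have h5 := mul_le_mul_of_nonneg_left h4 hS
      unfold headTail at h2
      linarith
    · push Not at h
      rw [linearCombination_apply_eq_zero h]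
      simpa using hB0
  | succ m ih =>
    rw [← le_div_iff₀' hSpos]
    refine tsAux_succ_le (div_nonneg hB0 hS) ((le_div_iff₀' hSpos).2 (ih a t hat B hB hB0))
      fun n E hE => ?_
    rw [le_div_iff₀' hSpos]
    -- Single out the first block $u_s$ met by the family: a point of some $E_j$ in its support
    -- bounds $n$.
    by_cases hmeet : ∃ i, i ∈ a.support ∧ ∃ j, ∃ e ∈ E j, e ∈ (u i).support
    swap
    · push Not at hmeet
      have : ∀ j, restr (E j) (Finsupp.linearCombination ℝ u a) = 0 := fun j =>
        restr_linearCombination_eq_zero fun i hi e he => hmeet i hi j e he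
      simpa [this, tsAux_zero_right] using hB0
    classical
    obtain ⟨hs, j₀, e₀, he₀, hes⟩ := Nat.find_spec hmeet
    have hsmin : ∀ i < Nat.find hmeet, ¬ (i ∈ a.support ∧ ∃ j, ∃ e ∈ E j, e ∈ (u i).support) :=
      fun i hi => Nat.find_min hmeet hi
    generalize Nat.find hmeet = s at hs hes hsmin
    have hn : n ≤ e₀ + 1 := hE.2 j₀ e₀ he₀
    set lab : ℕ → ℕ := fun i =>
      startedBefore E (u i).support + startedWithin E (u i).support with hlab
    have hlabK : ∀ i, lab i < 2 * n + 1 := by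
      intro i
      have h1 := startedBefore_le_startedWithin (E := E) (hne i)
      have h2 := startedWithin_le (E := E) (F := (u i).support)
      simp only [hlab]
      omega
    have hlabmono : Monotone lab := by
      intro i k hik
      rcases hik.eq_or_lt with rfl | hlt
      · exact le_rfl
      · have h1 := startedBefore_le_startedWithin (E := E) (hne i)
        have h2 := startedBefore_le_startedWithin (E := E) (hne k)
        have h3 : startedWithin E (u i).support ≤ startedBefore E (u k).support :=
          startedWithin_le_startedBefore (hu i k hlt)
        simp only [hlab]
        omega
    set b := a.filter (s < ·) with hb
    have hbs : ∀ i ∈ b.support, s < i := by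
      intro i hi
      rw [hb, Finsupp.support_filter, Finset.mem_filter] at hi
      exact hi.2
    set bl : ℕ → ℕ →₀ ℝ := fun l => b.filter fun i => lab i = l with hbl
    have hblmem : ∀ l, ∀ i ∈ (bl l).support, s + 1 ≤ i ∧ lab i = l := by
      intro l i hi
      rw [hbl, Finsupp.support_filter, Finset.mem_filter] at hi
      exact ⟨hbs i hi.1, hi.2⟩
    have hsplit : ∀ l, ∃ r, S * (1 / 2 * ∑ j, tsAux m (restr (E j)
        (Finsupp.linearCombination ℝ u (bl l)))) ≤ 1 / 2 * M (s + 1) *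
          (q ((bl l).filter (· < r)) + q ((bl l).filter (· = r)) +
            q ((bl l).filter (r < ·))) := by
      intro l
      refine exists_split_of_fibre hS hM hM2 hune hu hu1 hq hE
        (fun i hi => (hblmem l i hi).2) fun B' hB' => ?_
      refine ih _ (s + 1) (fun i hi => (hblmem l i hi).1) B' hB' ?_
      exact le_trans (add_nonneg (mul_nonneg hS (abs_nonneg _))
        (mul_nonneg (hM0 _) (apply_nonneg _ _))) (hB' (s + 1) le_rfl)
    choose r hr using hsplit
    -- Each of the $2n+1$ classes is refined into the parts before, at and after its split point. As
    -- $n\le e_0+1$, this gives at most $6e_0+9$ successive pieces.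
    set lab' : ℕ → ℕ := fun i =>
      3 * lab i + (if i < r (lab i) then 0 else if i = r (lab i) then 1 else 2) with hlab'
    have hlab'mono : Monotone lab' := by
      intro i k hik
      have h1 := hlabmono hik
      simp only [hlab']
      rcases h1.eq_or_lt with h | h
      · rw [h]
        split_ifs <;> omega
      · split_ifs <;> omega
    have hlab'K : ∀ i, lab' i < 3 * (2 * n + 1) := by
      intro i
      have := hlabK i
      simp only [hlab']
      split_ifs <;> omega
    have h3 := hθ s e₀ hes (3 * (2 * n + 1)) (by omega) lab' hlab'mono hlab'K b hbs
    have hpiece : ∀ l, b.filter (fun i => lab' i = 3 * l) = (bl l).filter (· < r l) ∧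
        b.filter (fun i => lab' i = 3 * l + 1) = (bl l).filter (· = r l) ∧
        b.filter (fun i => lab' i = 3 * l + 2) = (bl l).filter (r l < ·) := by
      intro l
      refine ⟨?_, ?_, ?_⟩ <;>
      · ext i
        simp only [hbl, hlab', Finsupp.filter_apply]
        by_cases hl : lab i = l
        · simp only [hl]
          rcases lt_trichotomy i (r l) with h | h | h
          · simp [h, h.ne, not_lt.2 h.le]
          · simp [h]
          · simp [h, h.ne', not_lt.2 h.le]
        · rw [if_neg, if_neg hl]
          · simp
          · split_ifs <;> omega
    rw [sum_range_three_mul] at h3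
    simp only [(hpiece _).1, (hpiece _).2.1, (hpiece _).2.2] at h3
    have hdecomp : ∀ j, tsAux m (restr (E j) (Finsupp.linearCombination ℝ u a)) ≤
        tsAux m (restr (E j) (a s • u s)) + ∑ l ∈ Finset.range (2 * n + 1),
          tsAux m (restr (E j) (Finsupp.linearCombination ℝ u (bl l))) := by
      intro j
      have hz : restr (E j) (Finsupp.linearCombination ℝ u (a.filter (· < s))) = 0 := by
        refine restr_linearCombination_eq_zero fun i hi e he heu => ?_
        rw [Finsupp.support_filter, Finset.mem_filter] at hi
        exact hsmin i hi.2 ⟨hi.1, j, e, he, heu⟩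
      have hsum : restr (E j) (Finsupp.linearCombination ℝ u b) =
          ∑ l ∈ Finset.range (2 * n + 1), restr (E j) (Finsupp.linearCombination ℝ u (bl l)) := by
        conv_lhs => rw [← sum_filter_label b hlabK, map_sum]
        exact Finsupp.filter_sum _ _
      conv_lhs => rw [filter_headTail_decomp a s, map_add, map_add, restr_add, restr_add, hz,
        zero_add, Finsupp.linearCombination_single]
      refine (tsAux_add _ _ _).trans (add_le_add le_rfl ?_)
      rw [hsum]
      exact tsAux_sum _ _ _
    have hhead : 1 / 2 * ∑ j, tsAux m (restr (E j) (a s • u s)) ≤ |a s| := by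
      refine (half_sum_tsAux_le_tsNorm hE m _).trans ?_
      rw [tsNorm_smul]
      exact mul_le_of_le_one_right (abs_nonneg _) (hu1 s)
    have hst : t ≤ s := hat s hs
    calc S * (1 / 2 * ∑ j, tsAux m (restr (E j) (Finsupp.linearCombination ℝ u a)))
        ≤ S * (1 / 2 * ∑ j, (tsAux m (restr (E j) (a s • u s)) +
            ∑ l ∈ Finset.range (2 * n + 1),
              tsAux m (restr (E j) (Finsupp.linearCombination ℝ u (bl l))))) := by
          gcongr with j
          exact hdecomp j
      _ = S * (1 / 2 * ∑ j, tsAux m (restr (E j) (a s • u s))) +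
            ∑ l ∈ Finset.range (2 * n + 1), S * (1 / 2 * ∑ j,
              tsAux m (restr (E j) (Finsupp.linearCombination ℝ u (bl l)))) := by
          rw [Finset.sum_add_distrib, Finset.sum_comm, mul_add, mul_add, ← Finset.mul_sum,
            ← Finset.mul_sum]
      _ ≤ S * |a s| + ∑ l ∈ Finset.range (2 * n + 1), 1 / 2 * M (s + 1) *
            (q ((bl l).filter (· < r l)) + q ((bl l).filter (· = r l)) +
              q ((bl l).filter (r l < ·))) := by
          exact add_le_add (mul_le_mul_of_nonneg_left hhead hS) (Finset.sum_le_sum fun l _ => hr l)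
      -- The classes lie beyond $s$, so they carry the smaller weight $M_{s+1}$; the drop from $M_s$
      -- pays for $\theta_s$ falling short of $1/2$.
      _ ≤ S * |a s| + M s * θ s * ∑ l ∈ Finset.range (2 * n + 1),
            (q ((bl l).filter (· < r l)) + q ((bl l).filter (· = r l)) +
              q ((bl l).filter (r l < ·))) := by
          rw [← Finset.mul_sum]
          refine add_le_add le_rfl (mul_le_mul_of_nonneg_right (hMθ s) ?_)
          positivity
      _ ≤ S * |a s| + M s * q b := by
          rw [mul_assoc]
          exact add_le_add le_rfl (mul_le_mul_of_nonneg_left h3 (hM0 s))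
      _ ≤ B := hB s hst

end LowerEstimate

/-! ### Block bases and admissible families -/

theorem schreierOne_subset_schreier_one (L : LimitChoice) {F : Finset ℕ} (hF : F ∈ schreierOne) :
    F ∈ schreier L 1 := by
  have h : schreier L 1 = familyComp schreierOne schreierZero := by
    unfold schreier
    rw [← zero_add (1 : Ordinal.{0}), Ordinal.limitRecOn_add_one,
      Ordinal.limitRecOn_zero]
  rw [h]
  have hmin : minSet (fun i : Fin F.card => ({F.orderEmbOfFin rfl i} : Finset ℕ)) = F := by
    simp only [minSet, Finset.coe_singleton, csInf_singleton]
    exact Finset.image_orderEmbOfFin_univ F rfl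
  refine ⟨F.card, fun i => {F.orderEmbOfFin rfl i}, ⟨fun i => Finset.singleton_nonempty _, ?_, ?_⟩,
    fun i => ?_, ?_⟩
  · intro i j hij a ha b hb
    rw [Finset.mem_singleton] at ha hb
    subst ha hb
    exact (F.orderEmbOfFin rfl).strictMono hij
  · rw [hmin]
    exact hF
  · simp [schreierZero]
  · ext a
    conv_lhs => rw [← Finset.image_orderEmbOfFin_univ F rfl]
    simp only [Finset.mem_image, Finset.mem_univ, true_and, Finset.mem_biUnion,
      Finset.mem_singleton]
    exact exists_congr fun i => eq_comm

section

variable {V : Type*} [AddCommGroup V] [Module ℝ V]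

theorem successive_of_successive_support {b : ℕ → ℕ →₀ ℝ}
    (hb : Successive fun i => (b i).support) {A B : ℕ →₀ ℝ}
    (h : ∀ i ∈ A.support, ∀ j ∈ B.support, i < j) :
    ∀ e ∈ (Finsupp.linearCombination ℝ b A).support,
      ∀ f ∈ (Finsupp.linearCombination ℝ b B).support, e < f := by
  intro e he f hf
  rw [Finsupp.mem_support_iff] at he hf
  have h1 : ∃ i ∈ A.support, e ∈ (b i).support := by
    by_contra! h1
    exact he (linearCombination_apply_eq_zero h1)
  have h2 : ∃ i ∈ B.support, f ∈ (b i).support := by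
    by_contra! h2
    exact hf (linearCombination_apply_eq_zero h2)
  obtain ⟨i, hi, hie⟩ := h1
  obtain ⟨j, hj, hjf⟩ := h2
  exact hb i j (h i hi j hj) e hie f hjf

theorem linearCombination_ne_zero {b : ℕ → ℕ →₀ ℝ} (hb0 : ∀ i, b i ≠ 0)
    (hb : Successive fun i => (b i).support) {A : ℕ →₀ ℝ} (hA : A ≠ 0) :
    Finsupp.linearCombination ℝ b A ≠ 0 := by
  obtain ⟨i, hi⟩ := Finsupp.support_nonempty_iff.2 hA
  obtain ⟨e, he⟩ := Finsupp.support_nonempty_iff.2 (hb0 i)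
  intro h
  have h1 := linearCombination_apply_of_mem hb A he
  rw [h] at h1
  exact mul_ne_zero (Finsupp.mem_support_iff.1 hi) (Finsupp.mem_support_iff.1 he) h1.symm

theorem linearCombination_linearCombination (x : ℕ → V) (b : ℕ → ℕ →₀ ℝ) (A : ℕ →₀ ℝ) :
    Finsupp.linearCombination ℝ x (Finsupp.linearCombination ℝ b A) =
      Finsupp.linearCombination ℝ (fun i => Finsupp.linearCombination ℝ x (b i)) A := by
  rw [Finsupp.apply_linearCombination]
  rfl

theorem IsBlockBasis.trans {x y z : ℕ → V} (h : IsBlockBasis x y) (h' : IsBlockBasis y z) :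
    IsBlockBasis x z := by
  obtain ⟨b, hb0, hb, hy⟩ := h
  obtain ⟨c, hc0, hc, hz⟩ := h'
  refine ⟨fun i => Finsupp.linearCombination ℝ b (c i),
    fun i => linearCombination_ne_zero hb0 hb (hc0 i),
    fun i j hij => successive_of_successive_support hb (hc i j hij), fun i => ?_⟩
  rw [linearCombination_linearCombination, hz, ← funext hy]

theorem IsBlockBasis.map {W : Type*} [AddCommGroup W] [Module ℝ W] {x y : ℕ → V} (f : V →ₗ[ℝ] W)
    (h : IsBlockBasis x y) : IsBlockBasis (fun i => f (x i)) fun i => f (y i) := by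
  obtain ⟨b, hb0, hb, hy⟩ := h
  refine ⟨b, hb0, hb, fun i => ?_⟩
  simp only [hy]
  rw [Finsupp.apply_linearCombination]
  rfl

theorem IsBlockBasis.refl (x : ℕ → V) : IsBlockBasis x x := by
  refine ⟨fun i => Finsupp.single i 1, fun i => by simp, fun i j hij a ha b hb => ?_,
    fun i => by simp⟩
  simp only [Finsupp.support_single i one_ne_zero, Finsupp.support_single j one_ne_zero,
    Finset.mem_singleton] at ha hb
  omega

theorem le_of_lt_asympConst {p : Seminorm ℝ V} {𝓕 : Set (Finset ℕ)} {x : ℕ → V} {δ : ℝ}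
    (h : δ < asympConst p 𝓕 x) {k : ℕ} (b : Fin k → ℕ →₀ ℝ)
    (hb : Admissible 𝓕 fun i => (b i).support) :
    δ * ∑ i, p (Finsupp.linearCombination ℝ x (b i)) ≤
      p (∑ i, Finsupp.linearCombination ℝ x (b i)) := by
  unfold asympConst at h
  obtain ⟨δ', hδ', hlt⟩ := exists_lt_of_lt_csSup
    (by exact ⟨0, le_rfl, fun k b _ => by simp [apply_nonneg]⟩) h
  refine le_trans ?_ (hδ'.2 k b hb)
  exact mul_le_mul_of_nonneg_right hlt.le (Finset.sum_nonneg fun i _ => apply_nonneg _ _)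

theorem sum_range_eq_sum_orderEmbOfFin {W A : Type*} [AddCommMonoid W] [Zero A] [DecidableEq A]
    {b : ℕ → A} {k : ℕ} {I : Finset ℕ} (hI : I = (Finset.range k).filter fun i => b i ≠ 0)
    {f : ℕ → W} (hf : ∀ i, b i = 0 → f i = 0) :
    ∑ i ∈ Finset.range k, f i = ∑ i, f (I.orderEmbOfFin rfl i) := by
  have h : ∑ i ∈ I, f i = ∑ i ∈ Finset.range k, f i := by
    rw [hI]
    exact Finset.sum_filter_of_ne fun i _ hi h0 => hi (hf i h0)
  rw [← h]
  conv_lhs => rw [← Finset.image_orderEmbOfFin_univ I rfl]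
  exact Finset.sum_image (I.orderEmbOfFin rfl).injective.injOn

/-- The lower `ℓ₁`-estimate for `k` successive, possibly zero, vectors supported on `[n + k, ∞)`. -/
theorem lower_estimate_of_lt_asympConst {L : LimitChoice} {p : Seminorm ℝ V} {z : ℕ → V} {n : ℕ}
    {δ : ℝ} (h : δ < asympConst p (schreier L 1) fun i => z (n + i)) {k : ℕ} {b : ℕ → ℕ →₀ ℝ}
    (hb : ∀ i j, i < j → ∀ e ∈ (b i).support, ∀ f ∈ (b j).support, e < f)
    (hk : ∀ i < k, ∀ e ∈ (b i).support, n + k ≤ e) :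
    δ * ∑ i ∈ Finset.range k, p (Finsupp.linearCombination ℝ z (b i)) ≤
      p (Finsupp.linearCombination ℝ z (∑ i ∈ Finset.range k, b i)) := by
  classical
  -- Admissible families consist of nonempty sets, so zero vectors are dropped. Re-indexing along
  -- the tail lowers positions by $n$, leaving at most $k$ supports, all at positions $\ge k$: a
  -- Schreier family.
  set I := (Finset.range k).filter fun i => b i ≠ 0 with hI
  have hIk : I.card ≤ k := (Finset.card_filter_le _ _).trans (Finset.card_range k).le
  set g := I.orderEmbOfFin rfl
  have hg : ∀ i, g i < k ∧ b (g i) ≠ 0 := fun i => by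
    have := I.orderEmbOfFin_mem rfl i
    exact ⟨Finset.mem_range.1 (Finset.mem_filter.1 this).1, (Finset.mem_filter.1 this).2⟩
  have hinj : Set.InjOn (fun i => n + i) Set.univ := fun i _ j _ hij => by simpa using hij
  set c : Fin I.card → ℕ →₀ ℝ := fun i =>
    (b (g i)).comapDomain (fun j => n + j) (hinj.mono (Set.subset_univ _)) with hc
  have hmap : ∀ i, (c i).mapDomain (fun j => n + j) = b (g i) := by
    intro i
    refine Finsupp.mapDomain_comapDomain _ (fun i j hij => by simpa using hij) _ fun e he => ?_
    have := hk _ (hg i).1 e he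
    exact ⟨e - n, by simp only; omega⟩
  have hsupp : ∀ i, ∀ e ∈ (c i).support, n + e ∈ (b (g i)).support := by
    intro i e he
    simpa [hc] using he
  have hcomb : ∀ i, Finsupp.linearCombination ℝ (fun j => z (n + j)) (c i) =
      Finsupp.linearCombination ℝ z (b (g i)) := by
    intro i
    rw [← hmap i, Finsupp.linearCombination_mapDomain]
    rfl
  have hc0 : ∀ i, (c i).support.Nonempty := by
    intro i
    rw [Finsupp.support_nonempty_iff]
    intro h0
    have := hmap i
    rw [h0, Finsupp.mapDomain_zero] at this
    exact (hg i).2 this.symm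
  have hadm : Admissible (schreier L 1) fun i => (c i).support := by
    refine ⟨hc0, fun i j hij e he f hf => ?_, schreierOne_subset_schreier_one L fun a ha => ?_⟩
    · have := hb _ _ (g.strictMono hij) _ (hsupp i e he) _ (hsupp j f hf)
      omega
    · have hcard : (minSet fun i => (c i).support).card ≤ I.card := by
        refine Finset.card_image_le.trans ?_
        simp
      obtain ⟨i, _, rfl⟩ := Finset.mem_image.1 ha
      have hmem : sInf ((c i).support : Set ℕ) ∈ (c i).support :=
        Finset.mem_coe.1 (Nat.sInf_mem (hc0 i))
      have := hk _ (hg i).1 _ (hsupp i _ hmem)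
      have hle : (minSet fun i => (c i).support).card ≤ sInf ((c i).support : Set ℕ) + 1 := by
        omega
      exact hle
  have key := le_of_lt_asympConst h c hadm
  simp only [hcomb] at key
  rw [← sum_range_eq_sum_orderEmbOfFin hI (f := fun i => p (Finsupp.linearCombination ℝ z (b i)))
      fun i hi => by simp [hi],
    ← sum_range_eq_sum_orderEmbOfFin hI (f := fun i => Finsupp.linearCombination ℝ z (b i))
      fun i hi => by simp [hi]] at key
  rwa [map_sum]

end

/-! ### Coordinates in Tsirelson's space. -/

theorem coe_linearCombination_tsBasis (c : ℕ →₀ ℝ) :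
    Finsupp.linearCombination ℝ tsBasis c = ((C00.of c : C00) : Tsirelson) := by
  induction c using Finsupp.induction_linear with
  | zero => rw [map_zero, map_zero, UniformSpace.Completion.coe_zero]
  | add f g hf hg => rw [map_add, hf, hg, map_add, UniformSpace.Completion.coe_add]
  | single i r =>
    rw [Finsupp.linearCombination_single, tsBasis, ← UniformSpace.Completion.coe_smul,
      ← map_smul, Finsupp.smul_single, smul_eq_mul, mul_one]

theorem norm_linearCombination_tsBasis (c : ℕ →₀ ℝ) :
    ‖Finsupp.linearCombination ℝ tsBasis c‖ = tsNorm c := by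
  rw [coe_linearCombination_tsBasis, UniformSpace.Completion.norm_coe, C00.norm_def,
    LinearEquiv.symm_apply_apply]

/-! ### Distortion -/

/-- A bound for the distortion from a sequence whose span nearly attains the upper bound of the
ratio of the norms. -/
theorem distortion_le_of_linearIndependent {X : Type*} [NormedAddCommGroup X] [NormedSpace ℝ X]
    {p : Seminorm ℝ X} (hp : IsEquivalentNorm p) {y : ℕ → X} (hy : LinearIndependent ℝ y)
    {S A B : ℝ} (hS : 0 < S)
    (h : ∀ a : ℕ →₀ ℝ, p (Finsupp.linearCombination ℝ y a) ≤
        A * S * ‖Finsupp.linearCombination ℝ y a‖ ∧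
      S * ‖Finsupp.linearCombination ℝ y a‖ ≤ B * p (Finsupp.linearCombination ℝ y a)) :
    distortion p ≤ ENNReal.ofReal (A * B) := by
  obtain ⟨c, C, hc, hcC⟩ := hp
  have hcont : Continuous p := by
    have hlip : LipschitzWith C.toNNReal p := by
      refine LipschitzWith.of_dist_le_mul fun v w => ?_
      rw [Real.dist_eq, dist_eq_norm]
      refine (abs_sub_map_le_sub p v w).trans ((hcC _).2.trans ?_)
      gcongr
      exact Real.le_coe_toNNReal C
    exact hlip.continuous
  set Y := (Submodule.span ℝ (Set.range y)).topologicalClosure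
  -- Both estimates are closed conditions, since equivalence makes $p$ continuous, so they pass from
  -- the span to its closure.
  have hY : ∀ v ∈ Y, p v ≤ A * S * ‖v‖ ∧ S * ‖v‖ ≤ B * p v := by
    have hcl : IsClosed {v | p v ≤ A * S * ‖v‖ ∧ S * ‖v‖ ≤ B * p v} :=
      (isClosed_le hcont (continuous_const.mul continuous_norm)).inter
        (isClosed_le (continuous_const.mul continuous_norm) (continuous_const.mul hcont))
    intro v hv
    refine closure_minimal (fun w hw => ?_) hcl hv
    obtain ⟨a, rfl⟩ := (Finsupp.mem_span_range_iff_exists_finsupp).1 hw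
    exact h a
  refine iInf_le_of_le Y (iInf_le_of_le (Submodule.isClosed_topologicalClosure _)
    (iInf_le_of_le ?_ ?_))
  · intro hfin
    have hmem : ∀ i, y i ∈ Y := fun i =>
      Submodule.le_topologicalClosure _ (Submodule.subset_span (Set.mem_range_self i))
    have hli : LinearIndependent ℝ fun i => (⟨y i, hmem i⟩ : Y) :=
      LinearIndependent.of_comp Y.subtype hy
    exact not_finite_iff_infinite.2 (inferInstanceAs (Infinite ℕ)) hli.finite
  · refine iSup_le fun u => iSup_le fun hu => iSup_le fun v => iSup_le fun hv => iSup_le fun hu1 =>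
      iSup_le fun hv1 => ENNReal.ofReal_le_ofReal ?_
    have h1 := (hY u hu).1
    have h2 := (hY v hv).2
    have h3 := (hcC v).1
    rw [hu1, mul_one] at h1
    rw [hv1, mul_one] at h2 h3
    have hpv : 0 < p v := hc.trans_le h3
    have hA : 0 ≤ A := by
      by_contra! hA
      have := apply_nonneg p u
      nlinarith
    rw [div_le_iff₀ hpv]
    nlinarith

/-- Halve $C$ until $P$ first fails; this happens at the latest once the value is below $c$. It
serves to locate, up to a factor $2$, the least $r$ with $p\le r\|\cdot\|$ on some tail. -/
theorem exists_threshold {c C : ℝ} (hc : 0 < c) {P : ℝ → Prop} (hC : P C) (hP : ∀ r < c, ¬ P r) :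
    ∃ S, 0 < S ∧ P (2 * S) ∧ ¬ P S := by
  classical
  have hex : ∃ j : ℕ, ¬ P (C / 2 ^ j) := by
    obtain ⟨j, hj⟩ := exists_pow_lt_of_lt_one (y := (1 / 2 : ℝ)) (x := c / (|C| + 1))
      (by positivity) (by norm_num)
    refine ⟨j, hP _ ?_⟩
    rw [lt_div_iff₀ (by positivity)] at hj
    calc C / 2 ^ j = (1 / 2) ^ j * C := by rw [div_pow, one_pow]; ring
      _ ≤ (1 / 2) ^ j * (|C| + 1) := by
        gcongr
        linarith [le_abs_self C]
      _ < c := hj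
  have hCc : c ≤ C := by
    by_contra! h
    exact hP C h hC
  obtain ⟨j, hj⟩ : ∃ j, Nat.find hex = j := ⟨_, rfl⟩
  have h1 := Nat.find_spec hex
  rw [hj] at h1
  cases j with
  | zero => simp [hC] at h1
  | succ j =>
    refine ⟨C / 2 ^ (j + 1), by have := hc.trans_le hCc; positivity, ?_, h1⟩
    have h2 := Nat.find_min hex (m := j) (by omega)
    rw [not_not] at h2
    convert h2 using 1
    rw [pow_succ]
    field_simp

/-! ### Choice of the weights and of the sparse block sequence. -/

/-- If `q` satisfies lower `ℓ₁`-estimates with constants tending rapidly to `1 / 2`, it dominates a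
fixed multiple of the Tsirelson norm of `∑ aᵢ uᵢ`. -/
theorem mul_tsNorm_le {S : ℝ} (hS : 0 ≤ S) {u : ℕ → ℕ →₀ ℝ} {q : Seminorm ℝ (ℕ →₀ ℝ)}
    (hune : ∀ i, u i ≠ 0) (hu : Successive fun i => (u i).support) (hu1 : ∀ i, tsNorm (u i) ≤ 1)
    (hq : ∀ i r, S * |r| ≤ q (Finsupp.single i r))
    (hθ : ∀ s, ∀ e ∈ (u s).support, ∀ K ≤ 6 * e + 9, ∀ lab : ℕ → ℕ, Monotone lab →
      (∀ i, lab i < K) → ∀ a : ℕ →₀ ℝ, (∀ i ∈ a.support, s < i) →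
      (1 / 2 - (1 / 2) ^ s / 8) * ∑ l ∈ Finset.range K, q (a.filter fun i => lab i = l) ≤ q a)
    (hθ' : ∀ lab : ℕ → ℕ, Monotone lab → (∀ i, lab i < 3) → ∀ a : ℕ →₀ ℝ,
      1 / 4 * ∑ l ∈ Finset.range 3, q (a.filter fun i => lab i = l) ≤ q a) (a : ℕ →₀ ℝ) :
    S * tsNorm (Finsupp.linearCombination ℝ u a) ≤ 16 * q a := by
  have hqa := apply_nonneg q a
  rcases hS.eq_or_lt with rfl | hSpos
  · linarith
  have hpow : ∀ s : ℕ, 0 ≤ (1 / 2 : ℝ) ^ s ∧ (1 / 2 : ℝ) ^ s ≤ 1 := fun s =>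
    ⟨by positivity, pow_le_one₀ (by norm_num) (by norm_num)⟩
  rw [← le_div_iff₀' hSpos]
  refine tsNorm_le_of_tsAux_le (by positivity) fun m => ?_
  rw [le_div_iff₀' hSpos]
  -- With $x=2^{-s}\le 1$: $\tfrac12M_{s+1}=1+\tfrac x2\le
  -- 1+\tfrac{3x}4-\tfrac{x^2}4=M_s\big(\tfrac12-\tfrac x8\big)$.
  refine mul_tsAux_le (M := fun s => 2 + 2 * (1 / 2) ^ s) (q := q) hS ?_ ?_ ?_ hune hu hu1 hq hθ
    m a 0 (fun i _ => Nat.zero_le i) _ fun s _ => ?_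
  · intro s t hst
    have := pow_le_pow_of_le_one (a := (1 / 2 : ℝ)) (by norm_num) (by norm_num) hst
    simp only
    linarith
  · intro s
    have := (hpow s).1
    linarith
  · intro s
    have h1 := (hpow s).1
    have h2 := (hpow s).2
    simp only [pow_succ]
    nlinarith
  -- Splitting at $s$ gives $S|a_s|+q(a_{>s})\le 4q(a)$, and $M_s\le 4$ yields the constant $16$.
  · have h1 := hθ' (fun i => if i < s then 0 else if i = s then 1 else 2)
      (fun i j hij => by simp only; split_ifs <;> omega) (fun i => by split_ifs <;> omega) a
    have h2 : a.filter (fun i => (if i < s then 0 else if i = s then 1 else 2) = 1) =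
        Finsupp.single s (a s) := by
      ext i
      rw [Finsupp.filter_apply, Finsupp.single_apply]
      rcases lt_trichotomy i s with h | h | h
      · simp [h, h.ne']
      · simp [h]
      · simp [h.ne, h.ne', not_lt.2 h.le]
    have h3 : a.filter (fun i => (if i < s then 0 else if i = s then 1 else 2) = 2) =
        a.filter (s < ·) := by
      ext i
      rw [Finsupp.filter_apply, Finsupp.filter_apply]
      rcases lt_trichotomy i s with h | h | h
      · simp [h, not_lt.2 h.le]
      · simp [h]
      · simp [h, h.ne', not_lt.2 h.le]
    simp only [Finset.sum_range_succ, Finset.sum_range_zero, h2, h3] at h1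
    have h4 := hq s (a s)
    have h5 := apply_nonneg q
      (a.filter fun i => (if i < s then 0 else if i = s then 1 else 2) = 0)
    have h6 := (hpow s).2
    have h7 := apply_nonneg q (a.filter (s < ·))
    have h8 : 0 ≤ S * |a s| := by positivity
    unfold headTail
    nlinarith

theorem theorem6p2 :
    ∃ D : ℝ, ∀ (L : LimitChoice) (x : ℕ → Tsirelson), IsBlockBasis tsBasis x →
      ∀ p : Seminorm ℝ (closedSpan x), IsEquivalentNorm p →
        (∃ γ ∈ deltaSpectrum L p (inClosedSpan x),
          γ ⟨1, Ordinal.one_lt_omega0.trans Ordinal.omega0_lt_omega_one⟩ = 1 / 2) →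
        distortion p ≤ ENNReal.ofReal D := by
  -- The $2$ is the loss in choosing the scale $S$, the $16$ that of the lower estimate.
  refine ⟨2 * 16, ?_⟩
  rintro L x hx p hp ⟨γ, ⟨z, hz, ε, -, hε0, hstab⟩, hγ⟩
  obtain ⟨w, hw0, hw, hzw⟩ : IsBlockBasis tsBasis fun i => (z i : Tsirelson) :=
    hx.trans (hz.map (closedSpan x).subtype)
  obtain ⟨m, hm⟩ := hstab ⟨1, Ordinal.one_lt_omega0.trans Ordinal.omega0_lt_omega_one⟩
  -- A tail is a block basis of itself, so stabilization applies to it directly.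
  have hdelta : ∀ η > 0, ∃ n, 1 / 2 - η < asympConst p (schreier L 1) fun i => z (n + i) := by
    intro η hη
    obtain ⟨n, hn, hεn⟩ := ((Filter.eventually_ge_atTop m).and
      (hε0.eventually_lt_const hη)).exists
    have h1 := hm n hn _ (IsBlockBasis.refl _)
    rw [hγ, abs_lt] at h1
    exact ⟨n, by linarith [h1.1]⟩
  choose! N hN using hdelta
  -- the vector with coordinates `c` with respect to `z` and its norm
  set Z : (ℕ →₀ ℝ) →ₗ[ℝ] closedSpan x := Finsupp.linearCombination ℝ z with hZ
  set W : (ℕ →₀ ℝ) →ₗ[ℝ] (ℕ →₀ ℝ) := Finsupp.linearCombination ℝ w with hW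
  have hnorm : ∀ c, ‖Z c‖ = tsNorm (W c) := by
    intro c
    rw [← norm_linearCombination_tsBasis, hW, linearCombination_linearCombination, ← funext hzw]
    exact congrArg norm (Finsupp.apply_linearCombination ℝ (closedSpan x).subtype z c)
  have hZ0 : ∀ c, c ≠ 0 → 0 < ‖Z c‖ := by
    intro c hc
    rw [hnorm]
    obtain ⟨e, he⟩ := Finsupp.support_nonempty_iff.2 (linearCombination_ne_zero hw0 hw hc)
    exact (abs_pos.2 (Finsupp.mem_support_iff.1 he)).trans_le (abs_apply_le_tsNorm _ e)
  obtain ⟨S, hS, ⟨n₀, hn₀⟩, hSlow⟩ : ∃ S, 0 < S ∧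
      (∃ n, ∀ c : ℕ →₀ ℝ, (∀ e ∈ c.support, n ≤ e) → p (Z c) ≤ 2 * S * ‖Z c‖) ∧
      ¬ ∃ n, ∀ c : ℕ →₀ ℝ, (∀ e ∈ c.support, n ≤ e) → p (Z c) ≤ S * ‖Z c‖ := by
    obtain ⟨c, C, hc, hcC⟩ := hp
    refine exists_threshold (P := fun r => ∃ n, ∀ c : ℕ →₀ ℝ, (∀ e ∈ c.support, n ≤ e) →
      p (Z c) ≤ r * ‖Z c‖) hc ⟨0, fun d _ => (hcC _).2⟩ ?_
    rintro r hr ⟨n, hn⟩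
    have h1 := hn (Finsupp.single n 1) (fun e he => by
      rw [Finsupp.support_single n one_ne_zero, Finset.mem_singleton] at he
      exact he.ge)
    have h2 := (hcC (Z (Finsupp.single n 1))).1
    have h3 := hZ0 (Finsupp.single n 1) (by simp)
    nlinarith
  have hvec : ∀ n, ∃ c : ℕ →₀ ℝ, c ≠ 0 ∧ (∀ e ∈ c.support, n ≤ e) ∧ ‖Z c‖ = 1 ∧ S ≤ p (Z c) := by
    intro n
    push Not at hSlow
    obtain ⟨c, hcn, hc⟩ := hSlow n
    have hc0 : c ≠ 0 := by
      rintro rfl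
      simp at hc
    have hpos := hZ0 c hc0
    refine ⟨‖Z c‖⁻¹ • c, smul_ne_zero (inv_ne_zero hpos.ne') hc0,
      fun e he => hcn e (Finsupp.support_smul he), ?_, ?_⟩
    · rw [map_smul, norm_smul, norm_inv, norm_norm, inv_mul_cancel₀ hpos.ne']
    · rw [map_smul, map_smul_eq_mul, norm_inv, norm_norm, ← div_eq_inv_mul, le_div_iff₀ hpos]
      exact hc.le
  choose v hv0 hvn hv1 hvS using hvec
  -- the starting points of the blocks
  set ℓ : ℕ → ℕ := fun i => Nat.rec (n₀ + N (1 / 4) + 3) (fun i l => l + (v l).support.sup id +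
    N ((1 / 2) ^ i / 8) + 6 * (W (v l)).support.sup id + 10) i with hℓ
  -- The support term keeps blocks successive, the `N` term makes the constant $\tfrac12-2^{-i}/8$
  -- available, and the last two leave room for $6e+9$ pieces for every $e$ in the $(e_j)$-support
  -- of block $i$. The initial value secures the upper estimate and the three-piece splitting from
  -- the start.
  have hℓs : ∀ i, ℓ (i + 1) = ℓ i + (v (ℓ i)).support.sup id + N ((1 / 2) ^ i / 8) +
      6 * (W (v (ℓ i))).support.sup id + 10 := fun i => rfl
  have hℓmono : Monotone ℓ := monotone_nat_of_le_succ fun i => by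
    rw [hℓs]
    omega
  set b : ℕ → ℕ →₀ ℝ := fun i => v (ℓ i) with hb
  have hbsucc : Successive fun i => (b i).support := by
    intro i j hij e he f hf
    have h1 : e ≤ (v (ℓ i)).support.sup id := Finset.le_sup (f := id) he
    have h2 := hvn _ f hf
    have h3 := hℓmono (Nat.succ_le_of_lt hij)
    rw [Nat.succ_eq_add_one, hℓs] at h3
    omega
  set Φ : (ℕ →₀ ℝ) →ₗ[ℝ] (ℕ →₀ ℝ) := Finsupp.linearCombination ℝ b with hΦ
  have hΦsupp : ∀ (t : ℕ) (a : ℕ →₀ ℝ), (∀ i ∈ a.support, t ≤ i) →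
      ∀ e ∈ (Φ a).support, ℓ t ≤ e := by
    intro t a ha e he
    rw [Finsupp.mem_support_iff] at he
    have : ∃ i ∈ a.support, e ∈ (b i).support := by
      by_contra! h
      exact he (linearCombination_apply_eq_zero h)
    obtain ⟨i, hi, hie⟩ := this
    exact (hℓmono (ha i hi)).trans (hvn _ e hie)
  -- A monotone labelling encodes a partition into $K$ successive, possibly empty, intervals of
  -- blocks.
  have hlower : ∀ η > 0, ∀ (t K : ℕ), N η + K ≤ ℓ t → ∀ lab : ℕ → ℕ, Monotone lab →
      (∀ i, lab i < K) → ∀ a : ℕ →₀ ℝ, (∀ i ∈ a.support, t ≤ i) →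
      (1 / 2 - η) * ∑ l ∈ Finset.range K, p (Z (Φ (a.filter fun i => lab i = l))) ≤
        p (Z (Φ a)) := by
    intro η hη t K hK lab hmono hlab a ha
    have h1 := lower_estimate_of_lt_asympConst (hN η hη) (k := K)
      (b := fun l => Φ (a.filter fun i => lab i = l)) ?_ ?_
    · rwa [← map_sum Φ, sum_filter_label a hlab] at h1
    · intro i j hij
      refine successive_of_successive_support hbsucc fun r hr s hs => ?_
      rw [Finsupp.support_filter, Finset.mem_filter] at hr hs
      by_contra! hsr
      have := hmono hsr
      omega
    · intro i _ e he
      refine hK.trans (hΦsupp t _ (fun r hr => ?_) e he)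
      rw [Finsupp.support_filter, Finset.mem_filter] at hr
      exact ha r hr.1
  have hΦW : ∀ a, W (Φ a) = Finsupp.linearCombination ℝ (fun i => W (b i)) a := fun a =>
    linearCombination_linearCombination _ _ _
  have hΦZ : ∀ a, Z (Φ a) = Finsupp.linearCombination ℝ (fun i => Z (b i)) a := fun a =>
    linearCombination_linearCombination _ _ _
  have hmain : ∀ a, S * ‖Z (Φ a)‖ ≤ 16 * p (Z (Φ a)) := by
    intro a
    rw [hnorm, hΦW]
    refine mul_tsNorm_le (q := p.comp (Z ∘ₗ Φ)) hS.le
      (fun i => linearCombination_ne_zero hw0 hw (hv0 _))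
      (fun i j hij => successive_of_successive_support hw (hbsucc i j hij))
      (fun i => by rw [← hnorm, hv1]) ?_ ?_ ?_ a
    · intro i r
      simp only [Seminorm.comp_apply, LinearMap.comp_apply, hΦ,
        Finsupp.linearCombination_single, map_smul, map_smul_eq_mul, Real.norm_eq_abs]
      rw [mul_comm]
      exact mul_le_mul_of_nonneg_left (hvS _) (abs_nonneg _)
    · intro s e he K hK lab hmono hlab a ha
      refine hlower _ (by positivity) (s + 1) K ?_ lab hmono hlab a ha
      have : e ≤ (W (v (ℓ s))).support.sup id := Finset.le_sup (f := id) he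
      rw [hℓs]
      omega
    · intro lab hmono hlab a
      have h1 := hlower (1 / 4) (by norm_num) 0 3
        (by show _ ≤ n₀ + N (1 / 4) + 3; omega) lab hmono hlab a (fun i _ => Nat.zero_le i)
      norm_num at h1 ⊢
      exact h1
  have hli : LinearIndependent ℝ fun i => Z (b i) := by
    rw [linearIndependent_iff]
    intro a ha
    by_contra ha0
    rw [← hΦZ] at ha
    have := hZ0 _ (linearCombination_ne_zero (fun i => hv0 _) hbsucc ha0)
    rw [← hΦ, ha, norm_zero] at this
    exact lt_irrefl _ this
  refine distortion_le_of_linearIndependent hp hli hS fun a => ?_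
  rw [← hΦZ]
  refine ⟨hn₀ _ fun e he => ?_, hmain a⟩
  refine le_trans ?_ (hΦsupp 0 a (fun i _ => Nat.zero_le i) e he)
  show n₀ ≤ n₀ + N (1 / 4) + 3
  omega
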